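/- Let $X$ be a path connected CW complex and let $A\subset X$ be a non-empty subcomplex that is contractible in $X$, i.e. the inclusion $A\hookrightarrow X$ is homotopic to a constant map. The Lusternik–Schnirelmann category $\mathrm{cat}\,X$ is the least $n$ such that $X$ has an open cover $\{U_0,\dots,U_n\}$ by $n+1$ sets, each contractible in $X$ (and $\mathrm{cat}\,X=\infty$ if there is no such $n$). Let $P_AX$ be the space of continuous paths $\phi:[0,1]\to X$ with $\phi(0)\in A$, with the compact-open topology, and let $p_A:P_AX\to X$, $p_A(\phi)=\phi(1)$. For $k\ge 0$ let $p_k:E_k(X,A)\to X$ (the $k$-th generalized Ganea fibration) be the fiberwise join of $k+1$ copies of $p_A$: the points of $E_k(X,A)$ are the formal convex combinations $\sum_{i=0}^k t_i\phi_i$ (with $t_i\ge 0$, $\sum_i t_i=1$, and $\phi_i\in P_AX$ disregarded when $t_i=0$) such that all $\phi_i$ with $t_i>0$ have the same end point $x=\phi_i(1)$, and $p_k$ sends such a combination to $x$; the topology on $E_k(X,A)$ is the coarsest one for which all barycentric coordinates $t_i$ are continuous, the sets $\{t_i>0\}$ are open, and the maps $\{t_i>0\}\to P_AX$, $\sum_j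 t_j\phi_j\mapsto\phi_i$, are continuous. Then for every integer $k\ge 0$, $\mathrm{cat}\,X\le k$ if and only if $p_k:E_k(X,A)\to X$ admits a section, i.e. a continuous map $s:X\to E_k(X,A)$ with $p_k\circ s=\mathrm{id}_X$. -/

import Mathlib

open Topology Set
open scoped unitInterval

/-! ### Lusternik–Schnirelmann category -/

/-- A subset `U` of a topological space `X` is *contractible in `X`* if its inclusion into `X` is
homotopic to a constant map. -/
def ContractibleIn {X : Type*} [TopologicalSpace X] (U : Set X) : Prop :=
  (⟨Subtype.val, continuous_subtype_val⟩ : C(U, X)).Nullhomotopic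

/-- `X` is covered by `n + 1` open sets `U 0, …, U n`, each of which is contractible in `X`. -/
def HasCategoricalCover (X : Type*) [TopologicalSpace X] (n : ℕ) : Prop :=
  ∃ U : Fin (n + 1) → Set X,
    (∀ i, IsOpen (U i)) ∧ (∀ i, ContractibleIn (U i)) ∧ ⋃ i, U i = univ

/-- The (normalized) Lusternik–Schnirelmann category: the least `n` such that `X` is covered by
`n + 1` open sets contractible in `X`, and `⊤` if there is no such `n`. -/
noncomputable def lsCat (X : Type*) [TopologicalSpace X] : ℕ∞ :=
  ⨅ (n : ℕ) (_ : HasCategoricalCover X n), (n : ℕ∞)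

/-! ### The path fibration from a subset -/

/-- The space of paths in `X` issued from `A`, with the compact-open topology. -/
abbrev PathsFrom {X : Type*} [TopologicalSpace X] (A : Set X) : Type _ :=
  {φ : C(I, X) // φ 0 ∈ A}

/-- The path fibration from `A`: it sends a path issued from `A` to its end point. -/
def pathFibration {X : Type*} [TopologicalSpace X] (A : Set X) : C(PathsFrom A, X) where
  toFun φ := φ.1 1
  continuous_toFun := (continuous_eval_const (1 : I)).comp continuous_subtype_val

/-! ### Joins and fiberwise joins -/

/-- The join of a finite family of spaces `E i`: its points are the formal convex combinations
`∑ i, t i • e i`, where the point `e i ∈ E i` is only remembered if `t i > 0`. -/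
structure FamilyJoin {ι : Type*} [Fintype ι] (E : ι → Type*) where
  /-- the barycentric coordinates -/
  weight : stdSimplex ℝ ι
  /-- the points of the factors that have a positive barycentric coordinate -/
  point : ∀ i, 0 < weight.1 i → E i

namespace FamilyJoin

/-- The coarsest topology for which the barycentric coordinates are continuous on the join, and
for every `i` the point of `E i` depends continuously on the element of the open set on which the
`i`-th barycentric coordinate is positive. -/
instance topology {ι : Type*} [Fintype ι] (E : ι → Type*) [∀ i, TopologicalSpace (E i)] :
    TopologicalSpace (FamilyJoin E) :=
  TopologicalSpace.induced weight inferInstance ⊓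
    ⨅ i, TopologicalSpace.generateFrom
      {S | ∃ V : Set (E i), IsOpen V ∧ S = {e | ∃ h : 0 < e.weight.1 i, e.point i h ∈ V}}

theorem continuous_weight {ι : Type*} [Fintype ι] (E : ι → Type*)
    [∀ i, TopologicalSpace (E i)] : Continuous (weight : FamilyJoin E → stdSimplex ℝ ι) :=
  continuous_iff_le_induced.2 inf_le_left

theorem isOpen_point_mem {ι : Type*} [Fintype ι] {E : ι → Type*}
    [∀ i, TopologicalSpace (E i)] (i : ι) {V : Set (E i)} (hV : IsOpen V) :
    IsOpen {e : FamilyJoin E | ∃ h : 0 < e.weight.1 i, e.point i h ∈ V} :=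
  (inf_le_right.trans (iInf_le _ i) :
    topology E ≤ TopologicalSpace.generateFrom
      {S | ∃ V : Set (E i), IsOpen V ∧ S = {e | ∃ h : 0 < e.weight.1 i, e.point i h ∈ V}}) _
    (TopologicalSpace.isOpen_generateFrom_of_mem ⟨V, hV, rfl⟩)

theorem exists_weight_pos {ι : Type*} [Fintype ι] {E : ι → Type*} (e : FamilyJoin E) :
    ∃ i, 0 < e.weight.1 i := by
  by_contra! h
  have h1 := e.weight.2.2
  have h2 : ∑ i, e.weight.1 i ≤ 0 := Finset.sum_nonpos fun i _ ↦ h i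
  linarith

end FamilyJoin

/-- The fiberwise join of a finite family of maps `p i : E i → B`: the subspace of the join of the
`E i` consisting of the combinations of points that all lie over one and the same point of `B`. -/
abbrev FiberwiseJoin {ι B : Type*} [Fintype ι] {E : ι → Type*} [TopologicalSpace B]
    [∀ i, TopologicalSpace (E i)] (p : ∀ i, C(E i, B)) : Type _ :=
  {e : FamilyJoin E // ∃ b, ∀ i (h : 0 < e.weight.1 i), p i (e.point i h) = b}

namespace FiberwiseJoin

/-- The projection of the fiberwise join, as a function: it sends a combination to the point of `B`
over which it lies. -/
noncomputable def projFun {ι B : Type*} [Fintype ι] {E : ι → Type*} [TopologicalSpace B]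
    [∀ i, TopologicalSpace (E i)] (p : ∀ i, C(E i, B)) (e : FiberwiseJoin p) : B :=
  e.2.choose

theorem projFun_eq {ι B : Type*} [Fintype ι] {E : ι → Type*} [TopologicalSpace B]
    [∀ i, TopologicalSpace (E i)] (p : ∀ i, C(E i, B)) (e : FiberwiseJoin p) (i : ι)
    (h : 0 < e.1.weight.1 i) : p i (e.1.point i h) = projFun p e :=
  e.2.choose_spec i h

theorem continuous_projFun {ι B : Type*} [Fintype ι] {E : ι → Type*} [TopologicalSpace B]
    [∀ i, TopologicalSpace (E i)] (p : ∀ i, C(E i, B)) : Continuous (projFun p) := by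
  rw [continuous_def]
  intro V hV
  have key : projFun p ⁻¹' V = ⋃ i, Subtype.val ⁻¹'
      {e : FamilyJoin E | ∃ h : 0 < e.weight.1 i, e.point i h ∈ p i ⁻¹' V} := by
    ext e
    simp only [mem_preimage, mem_iUnion, mem_ofPred_eq]
    constructor
    · intro he
      obtain ⟨i, hi⟩ := e.1.exists_weight_pos
      exact ⟨i, hi, by rwa [projFun_eq p e i hi]⟩
    · rintro ⟨i, hi, he⟩
      rwa [projFun_eq p e i hi] at he
  rw [key]
  exact isOpen_iUnion fun i ↦
    (FamilyJoin.isOpen_point_mem i (hV.preimage (p i).continuous)).preimage continuous_subtype_val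

/-- The projection of the fiberwise join onto the base. -/
noncomputable def proj {ι B : Type*} [Fintype ι] {E : ι → Type*} [TopologicalSpace B]
    [∀ i, TopologicalSpace (E i)] (p : ∀ i, C(E i, B)) : C(FiberwiseJoin p, B) :=
  ⟨projFun p, continuous_projFun p⟩

end FiberwiseJoin

/-! ### The generalized Ganea fibrations -/

/-- The total space `E_k(X, A)` of the `k`-th generalized Ganea fibration: the fiberwise join of
`k + 1` copies of the path fibration from `A`. -/
abbrev GaneaSpace {X : Type*} [TopologicalSpace X] (A : Set X) (k : ℕ) : Type _ :=
  FiberwiseJoin fun _ : Fin (k + 1) ↦ pathFibration A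

/-- The `k`-th generalized Ganea fibration `p_k : E_k(X, A) → X`. -/
noncomputable def ganeaFibration {X : Type*} [TopologicalSpace X] (A : Set X) (k : ℕ) :
    C(GaneaSpace A k, X) :=
  FiberwiseJoin.proj fun _ : Fin (k + 1) ↦ pathFibration A

/-! The link between the two sides is local: `p_A` has a section over `U` exactly when `U` is
contractible in `X`. By currying, a section over `U` is a homotopy from a map `U → A` to the
inclusion. Contracting `A` in `X` then contracts `U`; conversely, a reversed nullhomotopy of `U`,
preceded by a path from a point of `A`, is such a homotopy.

Given a section of the join, the open sets on which the barycentric coordinates are positive cover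
`X`, and the `i`-th point is a section of `p_A` over the `i`-th of them
(`FiberwiseJoin.exists_local_sections`). Conversely, a partition of unity subordinate to a
categorical cover supplies the weights that combine local sections (`FiberwiseJoin.exists_section`).
This needs `X` normal, which follows from a Tietze theorem proved by extending functions cell by
cell up the skeleta. -/

/-! ### Normality of CW complexes -/

section Normality

open RelCWComplex

/-- **Tietze extension theorem** relative to a compact subset of a Hausdorff space. -/
theorem IsCompact.exists_continuousOn_extension {X : Type*} [TopologicalSpace X] [T2Space X]
    {C S : Set X} (hC : IsCompact C) (hS : IsClosed S) (hSC : S ⊆ C) {h : X → ℝ}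
    (hh : ContinuousOn h S) : ∃ g : X → ℝ, ContinuousOn g C ∧ EqOn g h S := by
  classical
  have : CompactSpace C := isCompact_iff_compactSpace.1 hC
  have hS' : IsClosed ((↑) ⁻¹' S : Set C) := hS.preimage continuous_subtype_val
  let u : C(((↑) ⁻¹' S : Set C), ℝ) :=
    ⟨fun x ↦ h x.1.1, hh.comp_continuous
      (continuous_subtype_val.comp continuous_subtype_val) fun x ↦ x.2⟩
  obtain ⟨g, hg⟩ := u.exists_restrict_eq hS'
  refine ⟨fun x ↦ if hx : x ∈ C then g ⟨x, hx⟩ else 0, ?_, fun x hx ↦ ?_⟩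
  · rw [continuousOn_iff_continuous_domRestrict]
    refine g.continuous.congr fun x ↦ ?_
    simp
  · have := congr($hg ⟨⟨x, hSC hx⟩, hx⟩)
    simpa [hSC hx, u] using this

variable {X : Type*} [TopologicalSpace X] [T2Space X] [CWComplex (univ : Set X)]

/-- A function that is continuous on all closed cells of dimension less than `n` is continuous on
the boundary of every `n`-cell. -/
theorem Topology.CWComplex.continuousOn_cellFrontier {f : X → ℝ} {n : ℕ}
    (hf : ∀ m < n, ∀ i : cell (univ : Set X) m, ContinuousOn f (closedCell m i))
    (i : cell (univ : Set X) n) : ContinuousOn f (cellFrontier n i) := by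
  obtain ⟨J, hJ⟩ := CWComplex.cellFrontier_subset_finite_closedCell n i
  refine ContinuousOn.mono (s := ⋃ p : (Σ m : Fin n, {j // j ∈ J m}),
    closedCell (C := (univ : Set X)) p.1 p.2.1) ?_ ?_
  · exact (locallyFinite_of_finite _).continuousOn_iUnion
      (fun p ↦ isClosed_closedCell) fun p ↦ hf p.1 p.1.2 p.2.1
  · intro x hx
    obtain ⟨m, hm, j, hj, hxj⟩ : ∃ m < n, ∃ j ∈ J m, x ∈ closedCell m j := by
      simpa using hJ hx
    exact mem_iUnion.2 ⟨⟨⟨m, hm⟩, ⟨j, hj⟩⟩, hxj⟩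

/-- A function on a CW complex that is continuous on all closed cells is continuous. -/
theorem Topology.CWComplex.continuous_of_continuousOn_closedCell {f : X → ℝ}
    (hf : ∀ m, ∀ i : cell (univ : Set X) m, ContinuousOn f (closedCell m i)) : Continuous f := by
  refine continuous_iff_isClosed.2 fun F hF ↦ ?_
  refine (CWComplex.closed (univ : Set X) _ (subset_univ _)).2 fun n j ↦ ?_
  rw [inter_comm]
  exact (hf n j).preimage_isClosed_of_isClosed isClosed_closedCell hF

/-- Extension of a function from the union of a skeleton with a closed set over the next
skeleton. -/
theorem Topology.CWComplex.exists_extension_succ {K : Set X} (hK : IsClosed K) {u : X → ℝ}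
    (hu : ContinuousOn u K) (n : ℕ) {f : X → ℝ}
    (hf : ∀ m < n, ∀ i : cell (univ : Set X) m, ContinuousOn f (closedCell m i))
    (hfu : EqOn f u (K ∩ skeletonLT (univ : Set X) n)) :
    ∃ f' : X → ℝ,
      ((∀ m < n + 1, ∀ i : cell (univ : Set X) m, ContinuousOn f' (closedCell m i)) ∧
        EqOn f' u (K ∩ skeletonLT (univ : Set X) (n + 1 : ℕ))) ∧
      EqOn f' f (skeletonLT (univ : Set X) n) := by
  classical
  have key (i : cell (univ : Set X) n) : ∃ g : X → ℝ, ContinuousOn g (closedCell n i) ∧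
      EqOn g u (K ∩ closedCell n i) ∧ EqOn g f (cellFrontier n i) := by
    -- The frontier lies in the lower skeleton, where `f` already equals `u` on `K`. So the two
    -- prescriptions agree where both apply and glue to a continuous function on the closed set `(K
    -- ∩ closedCell n i) ∪ cellFrontier n i`.
    have hfr : EqOn (K.piecewise u f) f (cellFrontier n i) := fun x hx ↦ by
      by_cases hxK : x ∈ K
      · rw [piecewise_eq_of_mem _ _ _ hxK]
        exact (hfu ⟨hxK, cellFrontier_subset_skeletonLT n i hx⟩).symm
      · exact piecewise_eq_of_notMem _ _ _ hxK
    have hKu : EqOn (K.piecewise u f) u (K ∩ closedCell n i) := fun x hx ↦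
      piecewise_eq_of_mem _ _ _ hx.1
    have hc : IsClosed (K ∩ closedCell n i) := hK.inter isClosed_closedCell
    have hcf : IsClosed (cellFrontier n i) := isClosed_cellFrontier
    obtain ⟨g, hg, hgu⟩ := (isCompact_closedCell (n := n) (i := i)).exists_continuousOn_extension
      (hc.union hcf) (union_subset inter_subset_right (cellFrontier_subset_closedCell n i))
      (ContinuousOn.union_of_isClosed ((hu.mono inter_subset_left).congr hKu)
        ((CWComplex.continuousOn_cellFrontier hf i).congr hfr) hc hcf)
    exact ⟨g, hg, fun x hx ↦ (hgu (Or.inl hx)).trans (hKu hx),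
      fun x hx ↦ (hgu (Or.inr hx)).trans (hfr hx)⟩
  choose g hg hgu hgf using key
  -- Open cells are disjoint, so the chosen cell is the only one containing `x`. The value `0` is
  -- taken only off `skeletonLT (n + 1)`, where nothing is required yet.
  let f' : X → ℝ := fun x ↦ if x ∈ skeletonLT (univ : Set X) n then f x else
    if h : ∃ i : cell (univ : Set X) n, x ∈ openCell n i then g h.choose x else 0
  have hf' : EqOn f' f (skeletonLT (univ : Set X) n) := fun x hx ↦ if_pos hx
  have hf'g (i : cell (univ : Set X) n) : EqOn f' (g i) (closedCell n i) := fun x hx ↦ by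
    by_cases hxs : x ∈ skeletonLT (univ : Set X) n
    · have : x ∈ (skeletonLT (univ : Set X) n : Set X) ∩ closedCell n i := ⟨hxs, hx⟩
      rw [skeletonLT_inter_closedCell_eq_skeletonLT_inter_cellFrontier le_rfl] at this
      rw [hf' hxs, hgf i this.2]
    · have hxi : x ∈ openCell n i := by
        rw [← cellFrontier_union_openCell_eq_closedCell] at hx
        exact hx.resolve_left fun h ↦ hxs (cellFrontier_subset_skeletonLT n i h)
      have h : ∃ i : cell (univ : Set X) n, x ∈ openCell n i := ⟨i, hxi⟩
      have hi : h.choose = i := by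
        have := eq_of_not_disjoint_openCell (not_disjoint_iff.2 ⟨x, h.choose_spec, hxi⟩)
        simpa using this
      simp only [f', if_neg hxs, dif_pos h, hi]
  have hlt {m : ℕ} (hm : m < n) (i : cell (univ : Set X) m) :
      closedCell m i ⊆ skeletonLT (univ : Set X) n :=
    (closedCell_subset_skeletonLT m i).trans (skeletonLT_mono (by exact_mod_cast hm))
  refine ⟨f', ⟨fun m hm i ↦ ?_, fun x hx ↦ ?_⟩, hf'⟩
  · rcases Nat.lt_succ_iff_lt_or_eq.1 hm with hm | rfl
    · exact (hf m hm i).congr (hf'.mono (hlt hm i))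
    · exact (hg i).congr (hf'g i)
  · by_cases hxs : x ∈ skeletonLT (univ : Set X) n
    · exact (hf' hxs).trans (hfu ⟨hx.1, hxs⟩)
    · obtain ⟨i, hi⟩ : ∃ i, x ∈ closedCell n i := by
        have := hx.2
        rw [Nat.cast_add, Nat.cast_one,
          ← skeletonLT_union_iUnion_closedCell_eq_skeletonLT_succ] at this
        exact mem_iUnion.1 (this.resolve_left hxs)
      exact (hf'g i hi).trans (hgu i ⟨hx.1, hi⟩)

/-- **Tietze extension theorem** for CW complexes. -/
theorem Topology.CWComplex.exists_continuous_extension {K : Set X} (hK : IsClosed K) {u : X → ℝ}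
    (hu : ContinuousOn u K) : ∃ f : X → ℝ, Continuous f ∧ EqOn f u K := by
  choose! F hF hFe using fun (n : ℕ) (f : X → ℝ)
    (h : (∀ m < n, ∀ i : cell (univ : Set X) m, ContinuousOn f (closedCell m i)) ∧
      EqOn f u (K ∩ skeletonLT (univ : Set X) n)) ↦
    CWComplex.exists_extension_succ hK hu n h.1 h.2
  -- The starting function is arbitrary, since `skeletonLT 0` is empty.
  let f : ℕ → X → ℝ := Nat.rec 0 F
  have hf (n : ℕ) : (∀ m < n, ∀ i : cell (univ : Set X) m, ContinuousOn (f n) (closedCell m i)) ∧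
      EqOn (f n) u (K ∩ skeletonLT (univ : Set X) n) := by
    induction n with
    | zero =>
      refine ⟨fun m hm ↦ absurd hm (Nat.not_lt_zero m), fun x hx ↦ ?_⟩
      have := hx.2
      rw [Nat.cast_zero, CWComplex.skeletonLT_zero_eq_empty] at this
      exact this.elim
    | succ n ih => exact hF n (f n) ih
  have hfm {m n : ℕ} (hmn : m ≤ n) : EqOn (f n) (f m) (skeletonLT (univ : Set X) m) := by
    induction n, hmn using Nat.le_induction with
    | base => exact fun x _ ↦ rfl
    | succ n hmn ih =>
      intro x hx
      refine Eq.trans ?_ (ih hx)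
      exact hFe n (f n) (hf n) (skeletonLT_mono (by exact_mod_cast hmn) hx)
  have hex (x : X) : ∃ n : ℕ, x ∈ skeletonLT (univ : Set X) n := by
    have : x ∈ ⋃ n : ℕ, (skeletonLT (univ : Set X) n : Set X) := by
      rw [iUnion_skeletonLT_eq_complex]
      exact mem_univ x
    simpa using this
  choose N hN using hex
  -- The functions `f n` stabilise at each point, so the choice of `N x` does not affect the limit.
  have hfN {n : ℕ} {x : X} (hx : x ∈ skeletonLT (univ : Set X) n) : f (N x) x = f n x := by
    rcases le_total n (N x) with h | h
    · exact hfm h hx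
    · exact (hfm h (hN x)).symm
  refine ⟨fun x ↦ f (N x) x, CWComplex.continuous_of_continuousOn_closedCell fun m i ↦ ?_,
    fun x hx ↦ (hf (N x)).2 ⟨hx, hN x⟩⟩
  refine ((hf (m + 1)).1 m m.lt_succ_self i).congr fun x hx ↦ hfN (n := m + 1) ?_
  exact_mod_cast closedCell_subset_skeletonLT m i hx

variable (X) in
/-- CW complexes are normal. -/
theorem Topology.CWComplex.normalSpace : NormalSpace X where
  normal s t hs ht hst := by
    classical
    -- As in Urysohn's lemma: extend the function that is `0` on `s` and `1` on `t`, then cut at `1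
    -- / 2`.
    have hu : ContinuousOn (t.indicator (1 : X → ℝ)) (s ∪ t) :=
      ContinuousOn.union_of_isClosed
        (continuousOn_const.congr fun x hx ↦ indicator_of_notMem (disjoint_left.1 hst hx) _)
        (continuousOn_const.congr fun x hx ↦ indicator_of_mem hx _) hs ht
    obtain ⟨f, hf, hfu⟩ := CWComplex.exists_continuous_extension (hs.union ht) hu
    refine ⟨f ⁻¹' Iio (1 / 2), f ⁻¹' Ioi (1 / 2), isOpen_Iio.preimage hf, isOpen_Ioi.preimage hf,
      fun x hx ↦ ?_, fun x hx ↦ ?_, ?_⟩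
    · rw [mem_preimage, hfu (Or.inl hx), indicator_of_notMem (disjoint_left.1 hst hx)]
      norm_num
    · rw [mem_preimage, hfu (Or.inr hx), indicator_of_mem hx]
      norm_num
    · exact Disjoint.preimage f (disjoint_left.2 fun y hy hy' ↦ lt_asymm (mem_Iio.1 hy) hy')

end Normality

/-! ### Categorical covers -/

section Covers

variable {X : Type*} [TopologicalSpace X]

theorem HasCategoricalCover.mono {n k : ℕ} (h : HasCategoricalCover X n) (hnk : n ≤ k) :
    HasCategoricalCover X k := by
  obtain ⟨U, hUo, hUc, hU⟩ := h
  -- The cover is padded by repeating its last member.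
  refine ⟨fun j ↦ U ⟨min j n, by omega⟩, fun j ↦ hUo _, fun j ↦ hUc _, ?_⟩
  refine eq_univ_of_forall fun x ↦ ?_
  obtain ⟨i, hi⟩ := mem_iUnion.1 (hU ▸ mem_univ x)
  have : (⟨min i n, by omega⟩ : Fin (n + 1)) = i := Fin.ext (min_eq_left (by omega))
  exact mem_iUnion.2 ⟨⟨i, by omega⟩, this.symm ▸ hi⟩

theorem lsCat_le_iff {k : ℕ} : lsCat X ≤ k ↔ HasCategoricalCover X k := by
  refine ⟨fun h ↦ ?_, fun h ↦ iInf₂_le k h⟩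
  by_contra hk
  have : ((k + 1 : ℕ) : ℕ∞) ≤ lsCat X := le_iInf₂ fun n hn ↦ by
    by_contra! hlt
    exact hk (hn.mono (Nat.lt_succ_iff.1 (by exact_mod_cast hlt)))
  exact absurd (this.trans h) (by exact_mod_cast Nat.not_succ_le_self k)

/-- Over a set that is contractible in a path connected space, the path fibration from a nonempty
subset has a section. -/
theorem ContractibleIn.exists_pathFibration_section [PathConnectedSpace X] {A U : Set X}
    (hA : A.Nonempty) (hU : ContractibleIn U) :
    ∃ φ : C(U, PathsFrom A), ∀ x, pathFibration A (φ x) = x := by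
  obtain ⟨a, ha⟩ := hA
  obtain ⟨y, ⟨H⟩⟩ := hU
  -- The contraction may end at a point `y` outside `A`; `γ` moves the starting point of the paths
  -- into `A`.
  let γ : Path a y := (PathConnectedSpace.joined a y).somePath
  let G : (ContinuousMap.const U a).Homotopy (ContinuousMap.const U y) :=
    { toFun := fun p ↦ γ p.1
      continuous_toFun := γ.continuous.comp continuous_fst
      map_zero_left := fun _ ↦ γ.source
      map_one_left := fun _ ↦ γ.target }
  let K := G.trans H.symm
  let Φ : C(U, C(I, X)) := (K.toContinuousMap.comp ContinuousMap.prodSwap).curry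
  have hΦ (x : U) (t : I) : Φ x t = K (t, x) := rfl
  have hA (x : U) : Φ x 0 ∈ A := by
    rw [hΦ, K.apply_zero]
    exact ha
  exact ⟨⟨fun x ↦ ⟨Φ x, hA x⟩, Φ.continuous.subtype_mk hA⟩,
    fun x ↦ (hΦ x 1).trans (K.apply_one x)⟩

/-- If the path fibration from a subset contractible in the space has a section over `U`, then `U`
is contractible in the space. -/
theorem ContractibleIn.of_pathFibration_section {A U : Set X} (hA : ContractibleIn A)
    (φ : C(U, PathsFrom A)) (hφ : ∀ x, pathFibration A (φ x) = x) : ContractibleIn U := by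
  let ψ : C(U, A) := ⟨fun x ↦ ⟨(φ x).1 0, (φ x).2⟩,
    ((continuous_eval_const (0 : I)).comp
      (continuous_subtype_val.comp φ.continuous)).subtype_mk _⟩
  obtain ⟨y, hy⟩ := hA
  -- Running back along the paths `φ x` deforms the inclusion of `U` to the starting-point map `ψ`,
  -- which factors through `A`.
  refine ⟨y, ContinuousMap.Homotopic.trans ?_ (hy.comp (.refl ψ))⟩
  let Φ : C(U, C(I, X)) := ⟨fun x ↦ (φ x).1, continuous_subtype_val.comp φ.continuous⟩
  refine ContinuousMap.Homotopic.symm ⟨⟨Φ.uncurry.comp ContinuousMap.prodSwap, ?_, ?_⟩⟩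
  · exact fun x ↦ rfl
  · exact fun x ↦ hφ x

end Covers

/-! ### Sections of fiberwise joins -/

section Sections

/-- On the open set where the `i`-th barycentric coordinate is positive, the `i`-th point depends
continuously on the element of the join. -/
theorem FamilyJoin.continuous_point {ι : Type*} [Fintype ι] {E : ι → Type*}
    [∀ i, TopologicalSpace (E i)] (i : ι) :
    Continuous fun e : {e : FamilyJoin E // 0 < e.weight.1 i} ↦ e.1.point i e.2 := by
  refine continuous_def.2 fun V hV ↦ ?_
  refine isOpen_induced_iff.2 ⟨_, FamilyJoin.isOpen_point_mem i hV, ?_⟩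
  ext e
  exact ⟨fun ⟨_, h⟩ ↦ h, fun h ↦ ⟨e.2, h⟩⟩

theorem FamilyJoin.isOpen_weight_pos {ι : Type*} [Fintype ι] (E : ι → Type*)
    [∀ i, TopologicalSpace (E i)] (i : ι) : IsOpen {e : FamilyJoin E | 0 < e.weight.1 i} :=
  isOpen_lt continuous_const
    ((continuous_apply i).comp (continuous_subtype_val.comp (FamilyJoin.continuous_weight E)))

/-- A criterion for the continuity of a map into a join. -/
theorem FamilyJoin.continuous_mk {ι Y : Type*} [Fintype ι] {E : ι → Type*}
    [∀ i, TopologicalSpace (E i)] [TopologicalSpace Y] {w : Y → stdSimplex ℝ ι}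
    (hw : Continuous w) {U : ι → Set Y} (hU : ∀ i, IsOpen (U i)) (φ : ∀ i, C(U i, E i))
    (hwU : ∀ i y, 0 < (w y).1 i → y ∈ U i) :
    Continuous fun y ↦ (⟨w y, fun i h ↦ φ i ⟨y, hwU i y h⟩⟩ : FamilyJoin E) := by
  refine continuous_iff_coinduced_le.2 (le_inf (continuous_iff_coinduced_le.1
    (continuous_induced_rng.2 hw)) (le_iInf fun i ↦ continuous_iff_coinduced_le.1
      (continuous_generateFrom_iff.2 ?_)))
  rintro _ ⟨V, hV, rfl⟩
  have hpos : IsOpen {y | 0 < (w y).1 i} := isOpen_lt continuous_const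
    ((continuous_apply i).comp (continuous_subtype_val.comp hw))
  -- The `i`-th point is remembered only where its weight is positive, possibly a smaller set than
  -- `U i`; hence the intersection.
  convert hpos.inter ((hU i).isOpenMap_subtype_val _ (hV.preimage (φ i).continuous)) using 1
  ext y
  constructor
  · rintro ⟨h, hy⟩
    exact ⟨h, ⟨y, hwU i y h⟩, hy, rfl⟩
  · rintro ⟨h, ⟨y, hyU⟩, hy, rfl⟩
    exact ⟨h, hy⟩

variable {X : Type*} [TopologicalSpace X]

/-- Local sections over the members of a finite open cover of a normal space are combined into a
section of the fiberwise join. -/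
theorem FiberwiseJoin.exists_section [NormalSpace X] {ι : Type*} [Fintype ι] {E : ι → Type*}
    [∀ i, TopologicalSpace (E i)] (p : ∀ i, C(E i, X)) {U : ι → Set X} (hUo : ∀ i, IsOpen (U i))
    (hU : ⋃ i, U i = univ) (φ : ∀ i, C(U i, E i)) (hφ : ∀ i x, p i (φ i x) = x) :
    ∃ s : C(X, FiberwiseJoin p), ∀ x, proj p (s x) = x := by
  obtain ⟨ρ, hρ⟩ := PartitionOfUnity.exists_isSubordinate_of_locallyFinite isClosed_univ U hUo
    (locallyFinite_of_finite U) hU.ge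
  let w : X → stdSimplex ℝ ι := fun x ↦ ⟨fun i ↦ ρ i x, fun i ↦ ρ.nonneg i x, by
    rw [← finsum_eq_sum_of_fintype]
    exact ρ.sum_eq_one (mem_univ x)⟩
  have hw : Continuous w := (continuous_pi fun i ↦ (ρ i).continuous).subtype_mk _
  -- Subordination puts the closed support of `ρ i` inside `U i`, so `φ i` is defined wherever its
  -- weight is positive.
  have hwU (i : ι) (x : X) (h : 0 < (w x).1 i) : x ∈ U i := hρ i (subset_tsupport _ h.ne')
  let s : C(X, FiberwiseJoin p) :=
    ⟨fun x ↦ ⟨⟨w x, fun i h ↦ φ i ⟨x, hwU i x h⟩⟩, x, fun i h ↦ hφ i _⟩,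
      (FamilyJoin.continuous_mk hw hUo φ hwU).subtype_mk _⟩
  refine ⟨s, fun x ↦ ?_⟩
  obtain ⟨i, hi⟩ := (s x).1.exists_weight_pos
  exact (projFun_eq p (s x) i hi).symm.trans (hφ i _)

/-- A section of the fiberwise join restricts to local sections over the members of an open
cover. -/
theorem FiberwiseJoin.exists_local_sections {ι : Type*} [Fintype ι] {E : ι → Type*}
    [∀ i, TopologicalSpace (E i)] (p : ∀ i, C(E i, X)) (s : C(X, FiberwiseJoin p))
    (hs : ∀ x, proj p (s x) = x) :
    ∃ U : ι → Set X, (∀ i, IsOpen (U i)) ∧ ⋃ i, U i = univ ∧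
      ∀ i, ∃ φ : C(U i, E i), ∀ x, p i (φ x) = x := by
  have hsc : Continuous fun x ↦ (s x).1 := continuous_subtype_val.comp s.continuous
  refine ⟨fun i ↦ {x | 0 < (s x).1.weight.1 i},
    fun i ↦ (FamilyJoin.isOpen_weight_pos E i).preimage hsc,
    eq_univ_of_forall fun x ↦ mem_iUnion.2 (s x).1.exists_weight_pos, fun i ↦ ?_⟩
  refine ⟨⟨fun x ↦ (s x.1).1.point i x.2, (FamilyJoin.continuous_point i).comp
    (f := fun x : {x | 0 < (s x).1.weight.1 i} ↦
      (⟨(s x.1).1, x.2⟩ : {e : FamilyJoin E // 0 < e.weight.1 i}))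
    ((hsc.comp continuous_subtype_val).subtype_mk _)⟩, fun x ↦ ?_⟩
  exact (projFun_eq p (s x.1) i x.2).trans (hs x.1)

end Sections

theorem mainTheorem3 {X : Type*} [TopologicalSpace X] [T2Space X] [PathConnectedSpace X]
    [CWComplex (Set.univ : Set X)] (A : CWComplex.Subcomplex (Set.univ : Set X))
    (hne : (A : Set X).Nonempty) (hA : ContractibleIn (A : Set X)) (k : ℕ) :
    lsCat X ≤ (k : ℕ∞) ↔
      ∃ s : C(X, GaneaSpace (A : Set X) k), ∀ x, ganeaFibration (A : Set X) k (s x) = x := by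
  rw [lsCat_le_iff]
  constructor
  · rintro ⟨U, hUo, hUc, hU⟩
    have := CWComplex.normalSpace X
    choose φ hφ using fun i ↦ (hUc i).exists_pathFibration_section hne
    exact FiberwiseJoin.exists_section _ hUo hU φ hφ
  · rintro ⟨s, hs⟩
    obtain ⟨U, hUo, hU, hφ⟩ := FiberwiseJoin.exists_local_sections _ s hs
    refine ⟨U, hUo, fun i ↦ ?_, hU⟩
    obtain ⟨φ, h⟩ := hφ i
    exact hA.of_pathFibration_section φ h
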